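/- **Breather $T$-system of the dilute $A_5$ model in regime 2.** Let $L=5$, $\lambda=\frac{\pi(L+2)}{4(L+1)}=\frac{7\pi}{24}$, $P=\frac{4(L+1)}{L+2}=\frac{24}{7}$. Let $0<q<1$, $u\in\mathbb R$, $N\ge 0$ an even integer, $\ell\in\mathbb Z$, $w=e^{i\pi\ell/(L+1)}$ and $x_1,\dots,x_N\in\mathbb C$. Put $\vartheta_1(z)=2\sum_{n\ge0}(-1)^nq^{(n+1/2)^2}\sin((2n+1)z)$, $h[x]=\vartheta_1(i\lambda x)$, $$Q(x)=\prod_{j=1}^N h[x-x_j],\qquad \phi(x)=\Bigl(\frac{h[x+(\frac32-u)i]\,h[x-(\frac32-u)i]}{h[2i]\,h[3i]}\Bigr)^{N/2},$$ and assume the Bethe ansatz equations (with denominators cleared) $$w\,\frac{\phi(x_j+i)}{\phi(x_j-i)}=-\frac{Q(x_j-i)Q(x_j+2i)}{Q(x_j+i)Q(x_j-2i)},\qquad j=1,\dots,N.$$ Write $f(x\pm ia)=f(x+ia)f(x-ia)$. Define the boxes $$b_1(x)=w\,\phi(x+\tfrac32i)\phi(x+\tfrac12i)\frac{Q(x-\frac52i)}{Q(x-\frac12i)},\quad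 b_2(x)=\phi(x+\tfrac32i)\phi(x-\tfrac32i)\frac{Q(x-\frac32i)Q(x+\frac32i)}{Q(x-\frac12i)Q(x+\frac12i)},\quad b_3(x)=w^{-1}\phi(x-\tfrac32i)\phi(x-\tfrac12i)\frac{Q(x+\frac52i)}{Q(x+\frac12i)},$$ $f_m(x)=\prod_{j=1}^{m-1}\phi\bigl(x\pm i(\tfrac{2m-1}{2}-j)\bigr)$, and $T_m=0$ for $m<0$, $T_0=f_2$, $$T_m(x)=\frac1{f_m(x)}\sum_{1\le i_1\le\cdots\le i_m\le3}\ \prod_{k=1}^m b_{i_k}\bigl(x+i(2k-1-m)\bigr)\qquad(m\ge1).$$ For a skew Young diagram $\mu/\nu$ whose outer diagram $\mu$ has $\mu_1'$ rows, let $\Lambda_{\mu/\nu}(x)$ be the quantum Jacobi–Trudi determinant $$\det_{1\le j,k\le\mu_1'}\Bigl(T_{\mu_j-\nu_k-j+k}\bigl(x+i(\mu_1'-\mu_1+\mu_j+\nu_k-j-k+1)\bigr)\Bigr)$$ in which every $T_m$ with $m\ge 2L=10$ is replaced by $0$. Define $$T_{B_1}(x)=T_1(x),\qquad T_{B_3}(x)=\frac{\Lambda_{(8,1)}(x+\frac{13}{14}i)}{\phi(x-\frac{12}7i)},\qquad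 T_{B_5}(x)=\frac{\Lambda_{(15,8,8)/(7,7)}(x)}{\phi(x\pm\frac32i)},$$ $$T_{B_7}(x)=\frac{\Lambda_{(15,15,8,8)/(14,7,7)}(x+\frac{11}{14}i)}{\phi(x-\frac{12}7i)\,\phi(x\pm\frac97i)},\qquad T_{B_2}(x)=T_7(x),\qquad T^{(6)}(x)=\Lambda_{(8,7)/(6)}(x+\tfrac{25}{14}i).$$ Assume the duality $T_m(x)=T_{2L-1-m}(x+\tfrac P2i)$ for $m=0,1,\dots,2L$. Then $$T_{B_1}(x\pm\tfrac3{14}i)=T_0(x\pm\tfrac{11}{14}i)+\phi(x-\tfrac{12}7i)\,T_{B_3}(x),$$ $$T_{B_3}(x\pm\tfrac3{14}i)=T_0(x)\,T_0(x\pm\tfrac8{14}i)+T_{B_1}(x)\,T_{B_5}(x),$$ $$T_{B_5}(x\pm\tfrac3{14}i)=T_0(x\pm\tfrac3{14}i)\,T_0(x\pm\tfrac5{14}i)+T_{B_3}(x)\,T_{B_7}(x),$$ $$T_{B_2}(x\pm\tfrac3{14}i)=T_0(x\pm\tfrac1{14}i)+T^{(6)}(x).$$ The duality and these four relations are equalities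 of meromorphic functions of $x\in\mathbb C$, i.e. they hold for all $x$ outside a closed discrete set. -/

import Mathlib

open Filter

noncomputable section

namespace DiluteA5

/-- The elliptic theta function `ϑ₁(z)` of nome `q`,
`ϑ₁(z) = 2 ∑_{n ≥ 0} (-1)^n q^{(n+1/2)^2} sin((2n+1)z)`. -/
def theta1 (q : ℝ) (z : ℂ) : ℂ :=
  2 * ∑' n : ℕ, (-1 : ℂ) ^ n * ((q ^ (((n : ℝ) + 1 / 2) ^ 2) : ℝ) : ℂ) *
    Complex.sin ((2 * (n : ℂ) + 1) * z)

/-- The crossing parameter `λ = π (L + 2) / (4 (L + 1))` of regime 2, for `L = 5`. -/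
def crossing : ℝ := Real.pi * (5 + 2) / (4 * (5 + 1))

/-- The period `P = 4 (L + 1) / (L + 2)` of regime 2, for `L = 5`. -/
def period : ℝ := 4 * (5 + 1) / (5 + 2)

/-- `f(x ± i a) = f(x + i a) f(x - i a)`. -/
def pm (f : ℂ → ℂ) (a : ℝ) (x : ℂ) : ℂ :=
  f (x + Complex.I * (a : ℂ)) * f (x - Complex.I * (a : ℂ))

/-- The parameters of an eigenvalue of the quantum transfer matrix: the nome `q`, the spectral
parameter `u`, the Trotter number `N`, the sector `ℓ`, and the numbers `x_1, …, x_N`. -/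
structure Params where
  q : ℝ
  u : ℝ
  N : ℕ
  ell : ℤ
  root : Fin N → ℂ

namespace Params

variable (D : Params)

/-- `h[x] = ϑ₁(i λ x)`. -/
def h (x : ℂ) : ℂ := theta1 D.q (Complex.I * (crossing : ℂ) * x)

/-- `w = exp(i π ℓ / (L + 1))`, for `L = 5`. -/
def w : ℂ := Complex.exp (Complex.I * (Real.pi : ℂ) * (D.ell : ℂ) / (5 + 1))

/-- `Q(x) = ∏_j h[x - x_j]`. -/
def Q (x : ℂ) : ℂ := ∏ j : Fin D.N, D.h (x - D.root j)

/-- `φ(x) = (h[x + (3/2 - u) i] h[x - (3/2 - u) i] / (h[2i] h[3i]))^{N/2}`, for even `N`. -/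
def phi (x : ℂ) : ℂ :=
  (D.h (x + (3 / 2 - (D.u : ℂ)) * Complex.I) * D.h (x - (3 / 2 - (D.u : ℂ)) * Complex.I) /
    (D.h (2 * Complex.I) * D.h (3 * Complex.I))) ^ (D.N / 2)

/-- The Bethe ansatz equation
`w φ(x_j + i) / φ(x_j - i) = - Q(x_j - i) Q(x_j + 2i) / (Q(x_j + i) Q(x_j - 2i))`,
with the denominators cleared. -/
def BetheAnsatz : Prop :=
  ∀ j : Fin D.N,
    D.w * D.phi (D.root j + Complex.I) *
        (D.Q (D.root j + Complex.I) * D.Q (D.root j - 2 * Complex.I)) =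
      -(D.Q (D.root j - Complex.I) * D.Q (D.root j + 2 * Complex.I)) *
        D.phi (D.root j - Complex.I)

/-- The boxes with letters `1, 2, 3` (here `0, 1, 2`) and spectral parameter `x`: the three terms
of the eigenvalue of the fundamental quantum transfer matrix. -/
def box (a : Fin 3) (x : ℂ) : ℂ :=
  ![D.w * D.phi (x + 3 / 2 * Complex.I) * D.phi (x + 1 / 2 * Complex.I) *
      (D.Q (x - 5 / 2 * Complex.I) / D.Q (x - 1 / 2 * Complex.I)),
    D.phi (x + 3 / 2 * Complex.I) * D.phi (x - 3 / 2 * Complex.I) *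
      (D.Q (x - 3 / 2 * Complex.I) * D.Q (x + 3 / 2 * Complex.I) /
        (D.Q (x - 1 / 2 * Complex.I) * D.Q (x + 1 / 2 * Complex.I))),
    D.w⁻¹ * D.phi (x - 3 / 2 * Complex.I) * D.phi (x - 1 / 2 * Complex.I) *
      (D.Q (x + 5 / 2 * Complex.I) / D.Q (x + 1 / 2 * Complex.I))] a

/-- `f_m(x) = ∏_{j=1}^{m-1} φ(x ± i ((2m-1)/2 - j))`. -/
def f (m : ℕ) (x : ℂ) : ℂ :=
  ∏ j ∈ Finset.Ico 1 m, pm D.phi ((2 * (m : ℝ) - 1) / 2 - (j : ℝ)) x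

open Classical in
/-- The sum over the semistandard fillings `i_1 ≤ ⋯ ≤ i_m` of the `1 × m` diagram; the spectral
parameter is `x - i (m - 1)` in the leftmost box and increases by `2i` from box to box. -/
def rowSum (m : ℕ) (x : ℂ) : ℂ :=
  ∑ t : Fin m → Fin 3 with Monotone t,
    ∏ k : Fin m, D.box (t k) (x + Complex.I * (2 * ((k : ℕ) : ℂ) - ((m : ℂ) - 1)))

/-- The renormalized fusion transfer matrices: `T_m = 0` for `m < 0`, `T_0 = f_2`, and
`T_m(x) = (1 / f_m(x)) ∑_{i_1 ≤ ⋯ ≤ i_m} (row tableau)` for `m ≥ 1`. -/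
def T (m : ℤ) (x : ℂ) : ℂ :=
  if m < 0 then 0 else if m = 0 then D.f 2 x else D.rowSum m.toNat x / D.f m.toNat x

/-- The family `T_m` after the replacement `T_m → 0` for all `m ≥ 2L = 10`. -/
def Ttrunc (m : ℤ) (x : ℂ) : ℂ := if 10 ≤ m then 0 else D.T m x

end Params

/-- The quantum Jacobi-Trudi determinant of the skew diagram `μ/ν` with `μ'_1 = n + 1` rows, built
from a family `t_m` of functions:
`det_{1 ≤ j, k ≤ μ'_1} t_{μ_j - ν_k - j + k}(x + i (μ'_1 - μ_1 + μ_j + ν_k - j - k + 1))`.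
The indices `j, k : Fin (n + 1)` start at `0`, so that `j + 1, k + 1` take the place of `j, k`. -/
def jacobiTrudi (t : ℤ → ℂ → ℂ) {n : ℕ} (μ ν : Fin (n + 1) → ℤ) (x : ℂ) : ℂ :=
  Matrix.det (Matrix.of fun j k : Fin (n + 1) =>
    t (μ j - ν k - (((j : ℕ) : ℤ) + 1) + (((k : ℕ) : ℤ) + 1))
      (x + Complex.I *
        ((((n : ℤ) + 1) - μ 0 + μ j + ν k - (((j : ℕ) : ℤ) + 1) - (((k : ℕ) : ℤ) + 1) + 1 : ℤ) :
          ℂ)))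

namespace Params

variable (D : Params)

/-- `Λ_{μ/ν}`: the Jacobi-Trudi determinant in which every `T_m` with `m ≥ 2L` is replaced
by `0`. -/
def Lam {n : ℕ} (μ ν : Fin (n + 1) → ℤ) (x : ℂ) : ℂ := jacobiTrudi D.Ttrunc μ ν x

/-- The duality `T_m(x) = T_{2L-1-m}(x + (P/2) i)` for `m = 0, …, 2L`, with `L = 5`, as an equality
of meromorphic functions of `x`. -/
def Duality : Prop :=
  ∀ m : ℤ, 0 ≤ m → m ≤ 10 →
    D.T m =ᶠ[codiscrete ℂ] fun x => D.T (9 - m) (x + ((period / 2 : ℝ) : ℂ) * Complex.I)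

def TB1 (x : ℂ) : ℂ := D.T 1 x

def TB3 (x : ℂ) : ℂ :=
  D.Lam ![8, 1] ![0, 0] (x + 13 / 14 * Complex.I) / D.phi (x - 12 / 7 * Complex.I)

def TB5 (x : ℂ) : ℂ := D.Lam ![15, 8, 8] ![7, 7, 0] x / pm D.phi (3 / 2) x

def TB7 (x : ℂ) : ℂ :=
  D.Lam ![15, 15, 8, 8] ![14, 7, 7, 0] (x + 11 / 14 * Complex.I) /
    (D.phi (x - 12 / 7 * Complex.I) * pm D.phi (9 / 7) x)

def TB2 (x : ℂ) : ℂ := D.T 7 x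

def T6 (x : ℂ) : ℂ := D.Lam ![8, 7] ![6, 0] (x + 25 / 14 * Complex.I)

end Params

end DiluteA5

end

open Filter

namespace DiluteA5

/-! Applied twice, duality makes `T_m`, 0 ≤ m ≤ 9, periodic with period 24i/7; it also turns `T_8`,
`T_9` into `T_1`, `T_0`. Once `T_m` is dropped for m ≥ 10 and vanishes for m < 0, each Jacobi–Trudi
matrix is tridiagonal. The determinants for `TB3`, `TB5`, `TB7` thus become continuants K_2, K_3,
K_4 with shifts of `T_1` on the diagonal and products of two `T_0` as off-diagonal weights. The B1
and B2 relations are expansions of a 2 × 2 determinant. Those for B3 and B5 are the continuant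
identities K_2 K_2' = K_1 K_3 + (weights) and K_3 K_3' = K_2 K_4 + (weights). The φ-normalizations
match because `T_0` is a product of two φ's and φ has period 24i/7. Cancelling φ requires φ ≠ 0 off
a discrete set. By analyticity this fails only if φ ≡ 0, when all `T_m` vanish. -/

/-! ### Analyticity and quasi-periodicity of ϑ₁. -/

theorem norm_sin_le_exp_norm (z : ℂ) : ‖Complex.sin z‖ ≤ Real.exp ‖z‖ := by
  have h1 : ‖Complex.exp (-z * Complex.I)‖ ≤ Real.exp ‖z‖ := by
    simpa using Complex.norm_exp_le_exp_norm (-z * Complex.I)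
  have h2 : ‖Complex.exp (z * Complex.I)‖ ≤ Real.exp ‖z‖ := by
    simpa using Complex.norm_exp_le_exp_norm (z * Complex.I)
  have h3 := norm_sub_le (Complex.exp (-z * Complex.I)) (Complex.exp (z * Complex.I))
  rw [Complex.sin, norm_div, norm_mul, Complex.norm_I, mul_one, Complex.norm_ofNat]
  linarith

theorem summable_theta1_bound {q : ℝ} (hq0 : 0 < q) (hq1 : q < 1) (R : ℝ) :
    Summable fun n : ℕ =>
      q ^ (((n : ℝ) + 1 / 2) ^ 2) * Real.exp ((2 * (n : ℝ) + 1) * R) := by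
  have ha : 0 < -Real.log q := neg_pos.2 (Real.log_neg hq0 hq1)
  set a := -Real.log q with ha'
  refine Summable.of_nonneg_of_le (fun n => by positivity) (fun n => ?_)
    (Real.summable_exp_neg_nat.mul_left (Real.exp ((2 * R + 1) ^ 2 / (4 * a))))
  rw [Real.rpow_def_of_pos hq0, ← Real.exp_add, ← Real.exp_add, Real.exp_le_exp]
  -- Completing the square in n + 1/2 bounds the exponent by a constant minus n.
  have hsq : 0 ≤ (2 * a * ((n : ℝ) + 1 / 2) - (2 * R + 1)) ^ 2 / (4 * a) := by positivity
  have hexp : (2 * a * ((n : ℝ) + 1 / 2) - (2 * R + 1)) ^ 2 / (4 * a) =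
      a * ((n : ℝ) + 1 / 2) ^ 2 - ((n : ℝ) + 1 / 2) * (2 * R + 1) +
        (2 * R + 1) ^ 2 / (4 * a) := by
    field_simp
    ring
  have hlog : Real.log q = -a := by rw [ha', neg_neg]
  rw [hlog]
  nlinarith

theorem differentiable_theta1 {q : ℝ} (hq0 : 0 < q) (hq1 : q < 1) :
    Differentiable ℂ (theta1 q) := by
  intro z
  have hd : DifferentiableOn ℂ (fun z : ℂ => ∑' n : ℕ, (-1 : ℂ) ^ n *
      ((q ^ (((n : ℝ) + 1 / 2) ^ 2) : ℝ) : ℂ) * Complex.sin ((2 * (n : ℂ) + 1) * z))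
      (Metric.ball 0 (‖z‖ + 1)) := by
    refine Complex.differentiableOn_tsum_of_summable_norm
      (summable_theta1_bound hq0 hq1 (‖z‖ + 1)) (fun n => ?_) Metric.isOpen_ball
      (fun n y hy => ?_)
    · fun_prop
    · have hy' : ‖y‖ ≤ ‖z‖ + 1 := (mem_ball_zero_iff.1 hy).le
      have hn : ‖(2 * (n : ℂ) + 1)‖ = 2 * (n : ℝ) + 1 := by
        have : (2 * (n : ℂ) + 1) = ((2 * n + 1 : ℕ) : ℂ) := by push_cast; ring
        rw [this, Complex.norm_natCast]
        push_cast
        ring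
      rw [norm_mul, norm_mul, norm_pow, norm_neg, norm_one, one_pow, one_mul,
        Complex.norm_real, Real.norm_of_nonneg (by positivity)]
      refine mul_le_mul_of_nonneg_left ((norm_sin_le_exp_norm _).trans ?_) (by positivity)
      rw [norm_mul, hn, Real.exp_le_exp]
      gcongr
  have hz : Metric.ball (0 : ℂ) (‖z‖ + 1) ∈ nhds z :=
    Metric.isOpen_ball.mem_nhds (by simp)
  exact (hd.differentiableAt hz).const_mul 2

theorem theta1_sub_pi (q : ℝ) (z : ℂ) : theta1 q (z - Real.pi) = -theta1 q z := by
  unfold theta1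
  rw [← mul_neg, ← tsum_neg]
  congr 2
  funext n
  have : (2 * (n : ℂ) + 1) * (z - Real.pi) =
      (2 * (n : ℂ) + 1) * z - Real.pi - n * (2 * Real.pi) := by ring
  rw [this, Complex.sin_sub_nat_mul_two_pi, Complex.sin_sub_pi]
  ring

/-- Translation is a homeomorphism, so it preserves punctured neighbourhoods; the relations can then
be evaluated at shifted arguments. -/
theorem eventually_codiscrete_add {p : ℂ → Prop} (hp : ∀ᶠ x in codiscrete ℂ, p x) (c : ℂ) :
    ∀ᶠ x in codiscrete ℂ, p (x + c) := by
  rw [Filter.Eventually, mem_codiscrete] at hp ⊢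
  intro x
  have h := hp (x + c)
  rw [disjoint_principal_right, compl_compl] at h ⊢
  have ht : Tendsto (fun y : ℂ => y + c) (nhdsWithin x {x}ᶜ) (nhdsWithin (x + c) {x + c}ᶜ) := by
    refine tendsto_nhdsWithin_of_tendsto_nhds_of_eventually_within _
      ((continuous_id.add continuous_const).continuousAt.tendsto.mono_left nhdsWithin_le_nhds) ?_
    filter_upwards [self_mem_nhdsWithin] with y hy
    simpa using hy
  exact ht h

namespace Params

variable (D : Params)

/-- The period is chosen so that iλ · (24/7)i = -π, and ϑ₁ is π-antiperiodic. The two signs cancel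
in φ. -/
theorem h_add_period (x : ℂ) : D.h (x + 24 / 7 * Complex.I) = -D.h x := by
  rw [h, h, ← theta1_sub_pi]
  congr 1
  have : (crossing : ℂ) = 7 * Real.pi / 24 := by
    rw [crossing]
    push_cast
    ring
  rw [this]
  linear_combination (Real.pi : ℂ) * Complex.I_mul_I

theorem phi_add_period (x : ℂ) : D.phi (x + 24 / 7 * Complex.I) = D.phi x := by
  have h1 := D.h_add_period (x + (3 / 2 - (D.u : ℂ)) * Complex.I)
  have h2 := D.h_add_period (x - (3 / 2 - (D.u : ℂ)) * Complex.I)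
  rw [phi, phi, add_right_comm, h1, ← sub_add_eq_add_sub, h2, neg_mul_neg]

variable {D}

theorem differentiable_phi (hq0 : 0 < D.q) (hq1 : D.q < 1) : Differentiable ℂ D.phi := by
  have hh : Differentiable ℂ D.h :=
    (differentiable_theta1 hq0 hq1).comp (differentiable_id.const_mul _)
  unfold phi
  refine Differentiable.pow (Differentiable.div_const (Differentiable.mul ?_ ?_) _) _
  · exact hh.comp (differentiable_id.add_const _)
  · exact hh.comp (differentiable_id.sub_const _)

theorem phi_eq_zero_or_eventually_ne_zero (hq0 : 0 < D.q) (hq1 : D.q < 1) :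
    (∀ x, D.phi x = 0) ∨ ∀ᶠ x in codiscrete ℂ, D.phi x ≠ 0 := by
  have ha : AnalyticOnNhd ℂ D.phi Set.univ :=
    (differentiable_phi hq0 hq1).differentiableOn.analyticOnNhd isOpen_univ
  by_cases h0 : ∀ x, D.phi x = 0
  · exact Or.inl h0
  · refine Or.inr ?_
    push Not at h0
    obtain ⟨x, hx⟩ := h0
    have := ha.preimage_zero_mem_codiscrete (x := x) hx
    filter_upwards [this] with y hy using hy

theorem T_eq_zero_of_phi_eq_zero (hφ : ∀ x, D.phi x = 0) (m : ℤ) (x : ℂ) : D.T m x = 0 := by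
  have hbox : ∀ a y, D.box a y = 0 := by
    intro a y
    fin_cases a <;> simp [box, hφ]
  unfold T
  split_ifs with h1 h2
  · rfl
  · simp [f, pm, hφ]
  · have : NeZero m.toNat := ⟨by omega⟩
    rw [rowSum, Finset.sum_eq_zero, zero_div]
    intro t _
    exact Finset.prod_eq_zero (Finset.mem_univ 0) (hbox _ _)

theorem T_zero_apply (x : ℂ) :
    D.T 0 x = D.phi (x + 1 / 2 * Complex.I) * D.phi (x - 1 / 2 * Complex.I) := by
  simp only [T, f, pm, lt_irrefl, if_false, if_true]
  norm_num [Finset.prod_Ico_succ_top]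
  ring_nf

/-! ### Duality and periodicity on the lattice of shifts by i/14. -/

theorem Duality.eventually_eq (hdual : D.Duality) {m : ℤ} (h0 : 0 ≤ m) (h1 : m ≤ 10) (c : ℂ) :
    ∀ᶠ x in codiscrete ℂ, D.T m (x + c) = D.T (9 - m) (x + (c + 12 / 7 * Complex.I)) := by
  filter_upwards [eventually_codiscrete_add (hdual m h0 h1) c] with x hx
  rw [hx]
  congr 1
  rw [period]
  push_cast
  ring

theorem Duality.eventually_period (hdual : D.Duality) {m : ℤ} (h0 : 0 ≤ m) (h1 : m ≤ 9) (c : ℂ)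
    (n : ℕ) : ∀ᶠ x in codiscrete ℂ,
      D.T m (x + c) = D.T m (x + (c + n * (24 / 7 * Complex.I))) := by
  induction n with
  | zero => simp
  | succ n ih =>
    filter_upwards [ih, hdual.eventually_eq h0 (by omega) (c + n * (24 / 7 * Complex.I)),
      hdual.eventually_eq (m := 9 - m) (by omega) (by omega)
        (c + n * (24 / 7 * Complex.I) + 12 / 7 * Complex.I)] with x h1 h2 h3
    rw [h1, h2, h3, sub_sub_cancel]
    congr 2
    push_cast
    ring

/-- The value of a function at `x + i a / 14`. -/
noncomputable def shift (g : ℂ → ℂ) (x : ℂ) (a : ℤ) : ℂ := g (x + (a : ℂ) / 14 * Complex.I)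

theorem shift_congr {g : ℂ → ℂ} {x z : ℂ} (a : ℤ)
    (hz : z = x + (a : ℂ) / 14 * Complex.I) : g z = shift g x a := by
  rw [shift, hz]

/-- In units of i/14 duality is a shift by 24 and the period is 48. The two alternatives allow
periods to be removed or added with n natural. -/
theorem Duality.shift_dual (hdual : D.Duality) {m : ℤ} (h0 : 0 ≤ m) (h1 : m ≤ 9) (a b : ℤ) (n : ℕ)
    (hab : a + 24 = b + 48 * n ∨ a + 24 + 48 * n = b) :
    ∀ᶠ x in codiscrete ℂ, shift (D.T m) x a = shift (D.T (9 - m)) x b := by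
  have hd := hdual.eventually_eq h0 (by omega) ((a : ℂ) / 14 * Complex.I)
  rcases hab with hab | hab
  · filter_upwards [hd, hdual.eventually_period (m := 9 - m) (by omega) (by omega)
      ((b : ℂ) / 14 * Complex.I) n] with x h1 h2
    rw [shift, shift, h1, h2]
    congr 2
    have : (a : ℂ) + 24 = b + 48 * n := by exact_mod_cast hab
    linear_combination Complex.I / 14 * this
  · filter_upwards [hd, hdual.eventually_period (m := 9 - m) (by omega) (by omega)
      ((a : ℂ) / 14 * Complex.I + 12 / 7 * Complex.I) n] with x h1 h2
    rw [shift, shift, h1, h2]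
    congr 2
    have : (a : ℂ) + 24 + 48 * n = b := by exact_mod_cast hab
    linear_combination Complex.I / 14 * this

theorem Duality.shift_period (hdual : D.Duality) {m : ℤ} (h0 : 0 ≤ m) (h1 : m ≤ 9) (a b : ℤ)
    (n : ℕ) (hab : a = b + 48 * n) :
    ∀ᶠ x in codiscrete ℂ, shift (D.T m) x a = shift (D.T m) x b := by
  filter_upwards [hdual.eventually_period h0 h1 ((b : ℂ) / 14 * Complex.I) n] with x hx
  rw [shift, shift, hx, hab]
  congr 2
  push_cast
  ring

theorem eventually_shift_phi_ne_zero (hφ : ∀ᶠ x in codiscrete ℂ, D.phi x ≠ 0) (a : ℤ) :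
    ∀ᶠ x in codiscrete ℂ, shift D.phi x a ≠ 0 :=
  eventually_codiscrete_add hφ _

theorem shift_T_zero (x : ℂ) (a : ℤ) :
    shift (D.T 0) x a = shift D.phi x (a + 7) * shift D.phi x (a - 7) := by
  rw [shift, shift, shift, T_zero_apply]
  congr 2 <;> push_cast <;> ring

theorem shift_phi_period (x : ℂ) (a : ℤ) : shift D.phi x (a + 48) = shift D.phi x a := by
  rw [shift, shift, ← D.phi_add_period (x + (a : ℂ) / 14 * Complex.I)]
  congr 1
  push_cast
  ring

/-! ### Expansion of the truncated determinants. -/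

theorem Lam_8_1 (x : ℂ) (a : ℤ) : shift (D.Lam ![8, 1] ![0, 0]) x a =
    shift (D.T 8) x (a + 14) * shift (D.T 1) x (a - 112) -
      shift (D.T 9) x a * shift (D.T 0) x (a - 98) := by
  simp [shift, Lam, jacobiTrudi, Matrix.det_fin_two, Ttrunc]
  ring_nf

theorem Lam_8_7_6 (x : ℂ) (a : ℤ) : shift (D.Lam ![8, 7] ![6, 0]) x a =
    shift (D.T 2) x (a + 98) * shift (D.T 7) x (a - 28) -
      shift (D.T 9) x a * shift (D.T 0) x (a + 70) := by
  simp [shift, Lam, jacobiTrudi, Matrix.det_fin_two, Ttrunc]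
  ring_nf

/-- The corner entries have indices 17 and -1 and vanish; the diagonal carries `T_8`, `T_1`, `T_8`,
with `T_9` above it and `T_0` below. -/
theorem Lam_15_8_8 (x : ℂ) (a : ℤ) : shift (D.Lam ![15, 8, 8] ![7, 7, 0]) x a =
    shift (D.T 8) x (a + 126) * shift (D.T 1) x a * shift (D.T 8) x (a - 126) -
      shift (D.T 9) x (a + 112) * shift (D.T 0) x (a + 14) * shift (D.T 8) x (a - 126) -
      shift (D.T 8) x (a + 126) * shift (D.T 9) x (a - 112) * shift (D.T 0) x (a - 14) := by
  have hneg : ∀ y, D.T (-1) y = 0 := fun y => by simp [T]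
  simp [shift, Lam, jacobiTrudi, Matrix.det_fin_three, Ttrunc, hneg]
  ring_nf

theorem Lam_15_15_8_8 (x : ℂ) (a : ℤ) :
    shift (D.Lam ![15, 15, 8, 8] ![14, 7, 7, 0]) x a =
    shift (D.T 1) x (a + 238) * shift (D.T 8) x (a + 112) * shift (D.T 1) x (a - 14) *
        shift (D.T 8) x (a - 140) -
      shift (D.T 9) x (a + 126) * shift (D.T 0) x (a + 224) * shift (D.T 1) x (a - 14) *
        shift (D.T 8) x (a - 140) -
      shift (D.T 1) x (a + 238) * shift (D.T 9) x (a + 98) * shift (D.T 0) x a *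
        shift (D.T 8) x (a - 140) -
      shift (D.T 1) x (a + 238) * shift (D.T 8) x (a + 112) * shift (D.T 9) x (a - 126) *
        shift (D.T 0) x (a - 28) +
      shift (D.T 9) x (a + 126) * shift (D.T 0) x (a + 224) * shift (D.T 9) x (a - 126) *
        shift (D.T 0) x (a - 28) := by
  have hneg : ∀ m : ℤ, m < 0 → ∀ y, D.T m y = 0 := fun m hm y => by simp [T, hm]
  simp [shift, Lam, jacobiTrudi, Matrix.det_succ_row_zero, Fin.sum_univ_succ, Ttrunc, hneg,
    Fin.succAbove]
  ring_nf

/-- Clearing the denominator leaves the continuant of length 2. The general offset b allows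
evaluation at ±3 and at 0. -/
theorem Duality.TB3_mul_phi (hdual : D.Duality) (hφ : ∀ᶠ x in codiscrete ℂ, D.phi x ≠ 0)
    (b : ℤ) : ∀ᶠ x in codiscrete ℂ,
      shift D.phi x (b - 24) * shift D.TB3 x b =
        shift (D.T 1) x (b + 3) * shift (D.T 1) x (b - 3) -
          shift (D.T 0) x (b + 11) * shift (D.T 0) x (b - 11) := by
  filter_upwards [hdual.shift_dual (m := 8) (by simp) (by simp) (b + 13 + 14) (b + 3) 1 (by omega),
    hdual.shift_dual (m := 9) (by simp) (by simp) (b + 13) (b - 11) 1 (by omega),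
    hdual.shift_period (m := 1) (by simp) (by simp) (b - 3) (b + 13 - 112) 2 (by omega),
    hdual.shift_period (m := 0) (by simp) (by simp) (b + 11) (b + 13 - 98) 2 (by omega),
    eventually_shift_phi_ne_zero hφ (b - 24)] with x h1 h2 h3 h4 h5
  have hT : shift D.TB3 x b =
      shift (D.Lam ![8, 1] ![0, 0]) x (b + 13) / shift D.phi x (b - 24) := by
    simp only [shift, TB3]
    congr 2 <;> push_cast <;> ring
  rw [hT, mul_div_cancel₀ _ h5, Lam_8_1, h1, h2, h3, h4]
  norm_num
  ring

theorem Duality.TB5_mul_phi (hdual : D.Duality) (hφ : ∀ᶠ x in codiscrete ℂ, D.phi x ≠ 0)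
    (b : ℤ) : ∀ᶠ x in codiscrete ℂ,
      shift D.phi x (b + 21) * shift D.phi x (b - 21) * shift D.TB5 x b =
        shift (D.T 1) x (b + 6) * shift (D.T 1) x b * shift (D.T 1) x (b - 6) -
          shift (D.T 0) x (b - 8) * shift (D.T 0) x (b + 14) * shift (D.T 1) x (b - 6) -
          shift (D.T 1) x (b + 6) * shift (D.T 0) x (b + 8) * shift (D.T 0) x (b - 14) := by
  filter_upwards [hdual.shift_dual (m := 8) (by simp) (by simp) (b + 126) (b + 6) 3 (by omega),
    hdual.shift_dual (m := 8) (by simp) (by simp) (b - 126) (b - 6) 2 (by omega),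
    hdual.shift_dual (m := 9) (by simp) (by simp) (b + 112) (b - 8) 3 (by omega),
    hdual.shift_dual (m := 9) (by simp) (by simp) (b - 112) (b + 8) 2 (by omega),
    eventually_shift_phi_ne_zero hφ (b + 21),
    eventually_shift_phi_ne_zero hφ (b - 21)]
    with x h1 h2 h3 h4 h5 h6
  have hT : shift D.TB5 x b = shift (D.Lam ![15, 8, 8] ![7, 7, 0]) x b /
      (shift D.phi x (b + 21) * shift D.phi x (b - 21)) := by
    simp only [shift, TB5, pm]
    congr 3 <;> push_cast <;> ring
  rw [hT, mul_div_cancel₀ _ (mul_ne_zero h5 h6), Lam_15_8_8, h1, h2, h3, h4]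
  norm_num

theorem Duality.TB7_mul_phi (hdual : D.Duality) (hφ : ∀ᶠ x in codiscrete ℂ, D.phi x ≠ 0)
    (b : ℤ) : ∀ᶠ x in codiscrete ℂ,
      shift D.phi x (b - 24) * (shift D.phi x (b + 18) * shift D.phi x (b - 18)) *
          shift D.TB7 x b =
        shift (D.T 1) x (b + 9) * shift (D.T 1) x (b + 3) * shift (D.T 1) x (b - 3) *
            shift (D.T 1) x (b - 9) -
          shift (D.T 0) x (b + 17) * shift (D.T 0) x (b - 5) * shift (D.T 1) x (b - 3) *
            shift (D.T 1) x (b - 9) -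
          shift (D.T 1) x (b + 9) * shift (D.T 0) x (b - 11) * shift (D.T 0) x (b + 11) *
            shift (D.T 1) x (b - 9) -
          shift (D.T 1) x (b + 9) * shift (D.T 1) x (b + 3) * shift (D.T 0) x (b + 5) *
            shift (D.T 0) x (b - 17) +
          shift (D.T 0) x (b + 17) * shift (D.T 0) x (b - 5) * shift (D.T 0) x (b + 5) *
            shift (D.T 0) x (b - 17) := by
  filter_upwards [
    hdual.shift_period (m := 1) (by simp) (by simp) (b + 11 + 238) (b + 9) 5 (by omega),
    hdual.shift_dual (m := 8) (by simp) (by simp) (b + 11 + 112) (b + 3) 3 (by omega),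
    hdual.shift_dual (m := 8) (by simp) (by simp) (b + 11 - 140) (b - 9) 2 (by omega),
    hdual.shift_dual (m := 9) (by simp) (by simp) (b + 11 + 126) (b + 17) 3 (by omega),
    hdual.shift_period (m := 0) (by simp) (by simp) (b + 11 + 224) (b - 5) 5 (by omega),
    hdual.shift_dual (m := 9) (by simp) (by simp) (b + 11 + 98) (b - 11) 3 (by omega),
    hdual.shift_dual (m := 9) (by simp) (by simp) (b + 11 - 126) (b + 5) 2 (by omega),
    eventually_shift_phi_ne_zero hφ (b - 24),
    eventually_shift_phi_ne_zero hφ (b + 18),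
    eventually_shift_phi_ne_zero hφ (b - 18)]
    with x h1 h2 h3 h4 h5 h6 h7 h8 h9 h10
  have hT : shift D.TB7 x b =
      shift (D.Lam ![15, 15, 8, 8] ![14, 7, 7, 0]) x (b + 11) /
        (shift D.phi x (b - 24) * (shift D.phi x (b + 18) * shift D.phi x (b - 18))) := by
    simp only [shift, TB7, pm]
    refine congrArg₂ (· / ·) (congrArg _ ?_) (congrArg₂ (· * ·) (congrArg _ ?_)
      (congrArg₂ (· * ·) (congrArg _ ?_) (congrArg _ ?_))) <;> push_cast <;> ring
  have e1 : b + 11 - 14 = b - 3 := by ring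
  have e2 : b + 11 - 28 = b - 17 := by ring
  rw [hT, mul_div_cancel₀ _ (mul_ne_zero h8 (mul_ne_zero h9 h10)), Lam_15_15_8_8, h1, h2, h3, h4,
    h5, h6, h7, e1, e2]
  norm_num

theorem pm_eq_shift (g : ℂ → ℂ) (x : ℂ) (a : ℤ) (r : ℝ) (hr : r = a / 14) :
    pm g r x = shift g x a * shift g x (-a) := by
  simp only [shift, pm, hr]
  congr 2 <;> push_cast <;> ring

theorem shift_zero (g : ℂ → ℂ) (x : ℂ) : shift g x 0 = g x := by
  simp [shift]

/-! ### The four relations. -/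

theorem Duality.tSystem_B1 (hdual : D.Duality) (hφ : ∀ᶠ x in codiscrete ℂ, D.phi x ≠ 0) :
    pm D.TB1 (3 / 14) =ᶠ[codiscrete ℂ] fun x =>
      pm (D.T 0) (11 / 14) x + D.phi (x - 12 / 7 * Complex.I) * D.TB3 x := by
  filter_upwards [hdual.TB3_mul_phi hφ 0] with x hx
  have hp : D.phi (x - 12 / 7 * Complex.I) = shift D.phi x (0 - 24) :=
    shift_congr _ (by push_cast; ring)
  have h1 : D.TB1 = D.T 1 := rfl
  rw [pm_eq_shift _ _ 3 _ (by norm_num), pm_eq_shift _ _ 11 _ (by norm_num), hp,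
    ← shift_zero D.TB3, hx, h1]
  norm_num

theorem Duality.tSystem_B3 (hdual : D.Duality) (hφ : ∀ᶠ x in codiscrete ℂ, D.phi x ≠ 0) :
    pm D.TB3 (3 / 14) =ᶠ[codiscrete ℂ] fun x =>
      D.T 0 x * pm (D.T 0) (8 / 14) x + D.TB1 x * D.TB5 x := by
  filter_upwards [hdual.TB3_mul_phi hφ 3, hdual.TB3_mul_phi hφ (-3), hdual.TB5_mul_phi hφ 0,
    eventually_shift_phi_ne_zero hφ 21,
    eventually_shift_phi_ne_zero hφ (-21)] with x h1 h2 h3 h4 h5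
  have h6 := shift_phi_period (D := D) x (-27)
  have hB1 : D.TB1 = D.T 1 := rfl
  rw [pm_eq_shift _ _ 3 _ (by norm_num), pm_eq_shift _ _ 8 _ (by norm_num),
    ← shift_zero (D.T 0), hB1, ← shift_zero (D.T 1), ← shift_zero D.TB5]
  norm_num [shift_T_zero] at h1 h2 h3 h6 ⊢
  -- φ at -27 equals φ at 21, so both sides share the factor φ(21)φ(-21).
  rw [← h6] at h2
  refine mul_left_cancel₀ (mul_ne_zero h4 h5) ?_
  have h12 := congrArg₂ (· * ·) h1 h2
  -- The remaining weights balance because `T_0` at ±14 gives φ(21)φ(7)φ(-7)φ(-21), the common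
  -- factor times `T_0` at 0.
  linear_combination h12 - shift (D.T 1) x 0 * h3

theorem Duality.tSystem_B5 (hdual : D.Duality) (hφ : ∀ᶠ x in codiscrete ℂ, D.phi x ≠ 0) :
    pm D.TB5 (3 / 14) =ᶠ[codiscrete ℂ] fun x =>
      pm (D.T 0) (3 / 14) x * pm (D.T 0) (5 / 14) x + D.TB3 x * D.TB7 x := by
  filter_upwards [hdual.TB5_mul_phi hφ 3, hdual.TB5_mul_phi hφ (-3), hdual.TB3_mul_phi hφ 0,
    hdual.TB7_mul_phi hφ 0,
    eventually_shift_phi_ne_zero hφ 24,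
    eventually_shift_phi_ne_zero hφ 18,
    eventually_shift_phi_ne_zero hφ (-18)] with x h1 h2 h3 h4 h5 h6 h7
  have h8 := shift_phi_period (D := D) x (-24)
  rw [pm_eq_shift _ _ 3 _ (by norm_num), pm_eq_shift _ _ 3 _ (by norm_num),
    pm_eq_shift _ _ 5 _ (by norm_num), ← shift_zero D.TB3, ← shift_zero D.TB7]
  norm_num [shift_T_zero] at h1 h2 h3 h4 h8 ⊢
  -- Identifying φ at 24 and -24 makes both sides carry φ(24)²φ(18)φ(-18).
  rw [h8] at h1 h4 h5
  refine mul_left_cancel₀ (mul_ne_zero (mul_ne_zero h5 h5) (mul_ne_zero h6 h7)) ?_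
  have h12 := congrArg₂ (· * ·) h1 h2
  have h34 := congrArg₂ (· * ·) h3 h4
  -- The leftover weights are `T_0` at ±17, ±11, ±5; after removing the common factor, φ at ±10 and
  -- ±4 recombine into `T_0` at ±3.
  linear_combination h12 - h34

theorem Duality.tSystem_B2 (hdual : D.Duality) :
    pm D.TB2 (3 / 14) =ᶠ[codiscrete ℂ] fun x => pm (D.T 0) (1 / 14) x + D.T6 x := by
  filter_upwards [
    hdual.shift_dual (m := 2) (by simp) (by simp) (25 + 98) 3 3 (by omega),
    hdual.shift_dual (m := 9) (by simp) (by simp) 25 1 1 (by omega),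
    hdual.shift_period (m := 0) (by simp) (by simp) (25 + 70) (-1) 2 (by omega)] with x h1 h2 h3
  have hT : D.T6 x = shift (D.Lam ![8, 7] ![6, 0]) x 25 := by
    simp [shift, T6]
  have h7 : D.TB2 = D.T 7 := rfl
  rw [pm_eq_shift _ _ 3 _ (by norm_num), pm_eq_shift _ _ 1 _ (by norm_num), hT, h7, Lam_8_7_6, h1,
    h2, h3]
  norm_num

end Params

end DiluteA5

theorem mainTheorem2 (D : DiluteA5.Params) (hq0 : 0 < D.q) (hq1 : D.q < 1) (hN : Even D.N)
    (hBethe : D.BetheAnsatz) (hdual : D.Duality) :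
    (DiluteA5.pm D.TB1 (3 / 14) =ᶠ[Filter.codiscrete ℂ] fun x =>
      DiluteA5.pm (D.T 0) (11 / 14) x + D.phi (x - 12 / 7 * Complex.I) * D.TB3 x) ∧
    (DiluteA5.pm D.TB3 (3 / 14) =ᶠ[Filter.codiscrete ℂ] fun x =>
      D.T 0 x * DiluteA5.pm (D.T 0) (8 / 14) x + D.TB1 x * D.TB5 x) ∧
    (DiluteA5.pm D.TB5 (3 / 14) =ᶠ[Filter.codiscrete ℂ] fun x =>
      DiluteA5.pm (D.T 0) (3 / 14) x * DiluteA5.pm (D.T 0) (5 / 14) x + D.TB3 x * D.TB7 x) ∧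
    (DiluteA5.pm D.TB2 (3 / 14) =ᶠ[Filter.codiscrete ℂ] fun x =>
      DiluteA5.pm (D.T 0) (1 / 14) x + D.T6 x) := by
  rcases DiluteA5.Params.phi_eq_zero_or_eventually_ne_zero hq0 hq1 with hφ | hφ
  -- When φ ≡ 0 the first three relations read 0 = 0; the fourth involves no division by φ.
  · have hT := DiluteA5.Params.T_eq_zero_of_phi_eq_zero hφ
    refine ⟨.of_forall fun x => ?_, .of_forall fun x => ?_, .of_forall fun x => ?_,
      hdual.tSystem_B2⟩ <;>
    simp [DiluteA5.pm, DiluteA5.Params.TB1, DiluteA5.Params.TB3, DiluteA5.Params.TB5, hφ, hT]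
  · exact ⟨hdual.tSystem_B1 hφ, hdual.tSystem_B3 hφ, hdual.tSystem_B5 hφ, hdual.tSystem_B2⟩
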